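/- **Setting.** Let $\mathcal H_S$ be a Hilbert space, $D\in B(\mathcal H_S)$, $D_0=D$, $D_1=D^+$; on $\mathcal H_1=L^2(\mathbb R^d)$ let $H_1$ be multiplication by a real measurable function bounded below, $\beta>0$, $L=e^{-\beta H_1/2}$, $\omega_0\in\mathbb R$, $P_0$ an orthogonal projection commuting with $e^{itH_1}$ and $L$, $S_t=e^{it(H_1-\omega_0P_0)}$, and $g_0,g_1\in\mathcal H_1$ with $P_0g_0=g_0$, $P_0g_1=0$. Let $K\ni g_0,g_1$ be a subspace of the closed span of the vectors $S_tg_\varepsilon$ with $\int|\langle x,S_ty\rangle|\,dt<\infty$ and $\int|\langle x,S_tL^2y\rangle|\,dt<\infty$ for $x,y\in K$. Write $\langle x,P_Ey\rangle=\frac1{2\pi}\int\langle x,S_ty\rangle e^{-itE}dt$ and $$\gamma_\varepsilon(E)=\int_{-\infty}^0\langle g_\varepsilon,S_tg_\varepsilon\rangle e^{-itE}dt,\qquad n_\varepsilon(E)=\frac1{\langle g_\varepsilon,P_EL^2g_\varepsilon\rangle},\qquad T_\varepsilon(E)=\bigl(1+\gamma_\varepsilon(E)\gamma_{1-\varepsilon}(E)D_\varepsilon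 D_{1-\varepsilon}\bigr)^{-1},$$ where the inverse is assumed to exist for all $\varepsilon\in\{0,1\}$, $E\in\mathbb R$. Let $K\otimes_\beta K$ be the Hilbert space spanned by the symbols $x\otimes_\beta y$ ($x,y\in K$; linear in $x$, antilinear in $y$) with $$(x\otimes_\beta y\,|\,x'\otimes_\beta y')=\int\langle x,S_tx'\rangle\overline{\langle y,S_tL^2y'\rangle}\,dt,$$ $b_t$ the Boson white noise in the Fock space $\mathcal F(L^2(\mathbb R)\otimes(K\otimes_\beta K))$, $B_{a,b}(E,t)=b_t(g_a\otimes_\beta P_Eg_b)$, and $$N_{a,c}(t)=\int dE\sum_{\varepsilon'=0,1}n_{\varepsilon'}(E)B^+_{a,\varepsilon'}(E,t)B_{c,\varepsilon'}(E,t)$$ (where $\langle g_{\varepsilon'},P_EL^2g_{\varepsilon'}\rangle=0$ the noises $B_{a,\varepsilon'}(E,t)$ vanish and $n_{\varepsilon'}(E):=0$). **Limit equation.** Let $U_t$ ($t\ge0$) be an adapted process of bounded operators on $\mathcal H_S\otimes\mathcal F$ solving, in the sense of matrix elements between exponential vectors $\psi(f)$ of test functions $f(s)=\sum_j\varphi_j(s)\,x_j\otimes_\beta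 y_j$ ($\varphi_j\in C_c(\mathbb R)$, $x_j,y_j\in K$), $$\partial_tU_t=-i\sum_{\varepsilon=0,1}D_\varepsilon\otimes\Bigl(N_{\varepsilon,1-\varepsilon}(t)+\int dE\,\bigl(B_{1-\varepsilon,\varepsilon}(E,t)+B^+_{\varepsilon,1-\varepsilon}(E,t)\bigr)\Bigr)U_t,\qquad U_0=1,$$ with all integrals convergent. The products $B_{a,b}(E,t)U_t$ here are the causal ones, assumed continuous in $t\ge0$: $B_{a,b}(E,t)U_t$ equals the normally ordered product $U_tB_{a,b}(E,t)$ plus $\int_0^tds\,[B_{a,b}(E,t),\partial_sU_s]$, in which only the creators $B^+_{c,e}(E,s)$ standing at the left of $\partial_sU_s$ contribute, each with the commutator $$\lim_{\lambda\to0^+}\lambda^{-2}\langle g_a,S_{(s-t)/\lambda^2}g_c\rangle e^{-i(s-t)E/\lambda^2}\,\overline{\langle g_b,P_EL^2g_e\rangle}$$ (limit in the sense of distributions on $s\le t$) at equal energies, and a factor $\delta(E-E')$ in the energies. **Theorem.** For $\varepsilon\in\{0,1\}$ and $t>0$, in the sense of matrix elements between exponential vectors of test functions, the integral over $E$ on the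 right converges and $$\begin{aligned}-iD_\varepsilon N_{\varepsilon,1-\varepsilon}(t)U_t=-\int dE\Bigl(&\gamma_{1-\varepsilon}(E)D_\varepsilon D_{1-\varepsilon}T_\varepsilon(E)\bigl(-iD_\varepsilon\gamma_\varepsilon(E)B^+_{\varepsilon,1-\varepsilon}(E,t)+B^+_{\varepsilon,\varepsilon}(E,t)\bigr)U_t\\&+\sum_{\varepsilon'=0,1}n_{\varepsilon'}(E)\Bigl(iT_\varepsilon(E)D_\varepsilon B^+_{\varepsilon,\varepsilon'}(E,t)U_tB_{1-\varepsilon,\varepsilon'}(E,t)\\&\qquad+\gamma_{1-\varepsilon}(E)D_\varepsilon D_{1-\varepsilon}T_\varepsilon(E)B^+_{\varepsilon,\varepsilon'}(E,t)U_tB_{\varepsilon,\varepsilon'}(E,t)\Bigr)\Bigr).\end{aligned}$$ -/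

import Mathlib

open MeasureTheory Filter Topology Complex ComplexConjugate
open scoped ComplexOrder InnerProductSpace CompactlySupported

noncomputable section
namespace LowDensity

lemma posSemidef_gramKernel {X E : Type*} [SeminormedAddCommGroup E] [InnerProductSpace ℂ E]
    (v : X → E) : (Matrix.of fun x y => ⟪v x, v y⟫_ℂ).PosSemidef := by
  refine ⟨?_, fun c => ?_⟩
  · ext x y
    simp [Matrix.conjTranspose_apply]
  · have : (c.sum fun i xi => c.sum fun j xj =>
        star xi * (Matrix.of fun x y => ⟪v x, v y⟫_ℂ) i j * xj)
        = ⟪c.sum fun i xi => xi • v i, c.sum fun i xi => xi • v i⟫_ℂ := by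
      simp only [Finsupp.sum]
      rw [sum_inner]
      refine Finset.sum_congr rfl fun i _ => ?_
      rw [inner_sum]
      refine Finset.sum_congr rfl fun j _ => ?_
      simp only [RCLike.star_def, inner_smul_left, inner_smul_right, Matrix.of_apply]
      ring
    rw [this, inner_self_eq_norm_sq_to_K]
    exact (Complex.zero_le_real.2 (sq_nonneg ‖c.sum fun i xi => xi • v i‖)).trans_eq (by simp)

lemma posSemidef_smul_one {X V : Type*} [NormedAddCommGroup V] [InnerProductSpace ℂ V]
    [CompleteSpace V] {k : Matrix X X ℂ} (hk : k.PosSemidef) :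
    (Matrix.of fun x y => k x y • (1 : V →L[ℂ] V)).PosSemidef := by
  classical
  have hiff := (RKHS.posSemidef_tfae (K := Matrix.of fun x y => k x y • (1 : V →L[ℂ] V))).out 0 2
  refine hiff.mpr ⟨?_, fun w => ?_⟩
  · ext x y v
    have := hk.isHermitian.apply x y
    simp only [Matrix.conjTranspose_apply, Matrix.of_apply, star_smul, star_one, this]
  · have h := (hk.hadamard (posSemidef_gramKernel (fun x => w x))).2
      (w.mapRange (fun v => if v = 0 then (0 : ℂ) else 1) (by simp))
    rw [Finsupp.sum_mapRange_index (by simp)] at h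
    have h' := (Complex.le_def.1 h).1
    simp only [Complex.zero_re] at h'
    refine h'.trans_eq ?_
    simp only [RCLike.re_to_complex]
    congr 1
    refine Finsupp.sum_congr fun x hx => ?_
    rw [Finsupp.sum_mapRange_index (by simp)]
    refine Finsupp.sum_congr fun y hy => ?_
    rw [Finsupp.mem_support_iff] at hx hy
    have := hk.isHermitian.apply x y
    simp [hx, hy, inner_smul_left, ← this]

lemma posSemidef_of_tendsto {X : Type*} {k : ℕ → Matrix X X ℂ} {K : Matrix X X ℂ}
    (hk : ∀ n, (k n).PosSemidef) (h : ∀ x y, Tendsto (fun n => k n x y) atTop (𝓝 (K x y))) :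
    K.PosSemidef := by
  refine ⟨?_, fun c => ?_⟩
  · ext x y
    refine tendsto_nhds_unique ((h y x).star) ?_
    simpa only [(hk _).isHermitian.apply] using h x y
  · refine ge_of_tendsto' (x := atTop) (f := fun n => c.sum fun i xi => c.sum fun j xj => star xi * k n i j * xj)
      ?_ (fun n => (hk n).2 c)
    simp only [Finsupp.sum]
    exact tendsto_finsetSum _ fun i _ => tendsto_finsetSum _ fun j _ =>
      ((h i j).const_mul _).mul_const _

lemma posSemidef_exp {h : Type*} [NormedAddCommGroup h] [InnerProductSpace ℂ h] :
    (Matrix.of fun f g : h => Complex.exp ⟪f, g⟫_ℂ).PosSemidef := by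
  have hG : (Matrix.of fun f g : h => ⟪f, g⟫_ℂ).PosSemidef := posSemidef_gramKernel _
  have hp : ∀ n : ℕ, (Matrix.of fun f g : h => ⟪f, g⟫_ℂ ^ n).PosSemidef := by
    intro n
    induction n with
    | zero =>
      have := posSemidef_gramKernel (fun _ : h => (1 : ℂ))
      simpa using this
    | succ n ih =>
      have := ih.hadamard hG
      have e : (Matrix.of fun f g : h => ⟪f, g⟫_ℂ ^ (n + 1)) =
          (Matrix.of fun f g : h => ⟪f, g⟫_ℂ ^ n).hadamard (Matrix.of fun f g : h => ⟪f, g⟫_ℂ) := by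
        ext f g; simp [pow_succ]
      rw [e]; exact this
  refine posSemidef_of_tendsto
    (k := fun N => ∑ n ∈ Finset.range N, ((n.factorial : ℝ)⁻¹ : ℝ) •
      (Matrix.of fun f g : h => ⟪f, g⟫_ℂ ^ n)) (fun N => ?_) (fun f g => ?_)
  · refine Matrix.posSemidef_sum _ fun n _ => (hp n).smul (by positivity)
  · have := (NormedSpace.expSeries_div_hasSum_exp (𝔸 := ℂ) (⟪f, g⟫_ℂ)).tendsto_sum_nat
    rw [← Complex.exp_eq_exp_ℂ] at this
    refine this.congr fun N => ?_
    rw [Matrix.sum_apply]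
    refine Finset.sum_congr rfl fun n _ => ?_
    simp [div_eq_inv_mul]

lemma integral_nonneg_of_gram {H : Type*} [NormedAddCommGroup H] [InnerProductSpace ℂ H]
    [CompleteSpace H] {F : ℝ → H} (hF : Continuous F) {φ : ℝ → ℂ} (hφ : Integrable φ)
    (h : ∀ r s, ⟪F r, F s⟫_ℂ = φ (s - r)) : 0 ≤ ∫ t, φ t := by
  have key : ∀ T : ℝ, 0 < T → 0 ≤ (∫ x in (0:ℝ)..1, ∫ u in (-(T * x))..(T * (1 - x)), φ u).re := by
    intro T hT
    have e1 : ⟪∫ r in (0:ℝ)..T, F r, ∫ s in (0:ℝ)..T, F s⟫_ℂ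
        = ∫ r in (0:ℝ)..T, ∫ u in (-r)..(T - r), φ u := by
      rw [← inner_conj_symm, intervalIntegral.integral_of_le hT.le (f := F),
        ← integral_inner (hF.integrableOn_Ioc), ← integral_conj,
        intervalIntegral.integral_of_le hT.le]
      refine integral_congr_ae (Eventually.of_forall fun r => ?_)
      simp only [inner_conj_symm]
      rw [← integral_inner (hF.integrableOn_Ioc), ← intervalIntegral.integral_of_le hT.le]
      simp only [h]
      rw [intervalIntegral.integral_comp_sub_right (fun u => φ u) r]
      simp
    have e2 : (∫ r in (0:ℝ)..T, ∫ u in (-r)..(T - r), φ u)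
        = T • ∫ x in (0:ℝ)..1, ∫ u in (-(T * x))..(T * (1 - x)), φ u := by
      have := intervalIntegral.smul_integral_comp_mul_left (a := 0) (b := 1)
        (fun r => ∫ u in (-r)..(T - r), φ u) T
      simp only [mul_zero, mul_one] at this
      rw [← this]
      simp only [mul_sub, mul_one]
    have e3 : 0 ≤ (⟪∫ r in (0:ℝ)..T, F r, ∫ s in (0:ℝ)..T, F s⟫_ℂ).re :=
      inner_self_nonneg (𝕜 := ℂ)
    rw [e1, e2, Complex.smul_re, smul_eq_mul] at e3
    exact nonneg_of_mul_nonneg_right e3 hT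
  have lim : Tendsto (fun n : ℕ => ∫ x in (0:ℝ)..1, ∫ u in (-((n:ℝ) * x))..((n:ℝ) * (1 - x)), φ u)
      atTop (𝓝 (∫ _ in (0:ℝ)..1, ∫ t, φ t)) := by
    refine intervalIntegral.tendsto_integral_filter_of_dominated_convergence
      (fun _ => ∫ t, ‖φ t‖) ?_ ?_ (by simp) ?_
    · refine Eventually.of_forall fun n => Continuous.aestronglyMeasurable ?_
      have hc : Continuous fun y : ℝ => ∫ u in (0:ℝ)..y, φ u :=
        intervalIntegral.continuous_primitive (fun a b => hφ.intervalIntegrable) 0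
      have : (fun x : ℝ => ∫ u in (-((n:ℝ) * x))..((n:ℝ) * (1 - x)), φ u) = fun x =>
          (∫ u in (0:ℝ)..((n:ℝ) * (1 - x)), φ u) - ∫ u in (0:ℝ)..(-((n:ℝ) * x)), φ u := by
        ext x
        rw [intervalIntegral.integral_interval_sub_left hφ.intervalIntegrable
          hφ.intervalIntegrable]
      rw [this]
      exact (hc.comp (by fun_prop)).sub (hc.comp (by fun_prop))
    · refine Eventually.of_forall fun n => Eventually.of_forall fun x _ => ?_
      refine (intervalIntegral.norm_integral_le_integral_norm_uIoc).trans ?_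
      exact setIntegral_le_integral hφ.norm (Eventually.of_forall fun _ => norm_nonneg _)
    · have : ∀ᵐ x : ℝ, x ≠ 1 := by simp [ae_iff]
      filter_upwards [this] with x hx1 hx
      rw [Set.uIoc_of_le zero_le_one] at hx
      have hx' : x < 1 := lt_of_le_of_ne hx.2 hx1
      refine intervalIntegral_tendsto_integral hφ ?_ ?_
      · exact tendsto_neg_atTop_atBot.comp (tendsto_natCast_atTop_atTop.atTop_mul_const hx.1)
      · exact tendsto_natCast_atTop_atTop.atTop_mul_const (by linarith)
  have := (Complex.continuous_re.tendsto _).comp lim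
  simp only [intervalIntegral.integral_const, sub_zero, one_smul] at this
  have hre : 0 ≤ (∫ t, φ t).re := by
    refine ge_of_tendsto this ?_
    filter_upwards [eventually_gt_atTop 0] with n hn
    exact key n (by exact_mod_cast hn)
  have hconj : conj (∫ t, φ t) = ∫ t, φ t := by
    rw [← integral_conj, ← integral_neg_eq_self]
    refine integral_congr_ae (Eventually.of_forall fun t => ?_)
    have h1 := h t 0
    have h2 := h 0 t
    rw [zero_sub] at h1
    rw [sub_zero] at h2
    simp only
    rw [← h1, ← h2, inner_conj_symm]
  exact Complex.le_def.2 ⟨hre, (Complex.conj_eq_iff_im.1 hconj).symm⟩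

lemma continuous_of_gram {H : Type*} [NormedAddCommGroup H] [InnerProductSpace ℂ H]
    {F : ℝ → H} {φ : ℝ → ℂ} (hφ : Continuous φ)
    (h : ∀ r s, ⟪F r, F s⟫_ℂ = φ (s - r)) : Continuous F := by
  rw [continuous_iff_continuousAt]
  intro r
  rw [ContinuousAt, tendsto_iff_norm_sub_tendsto_zero]
  have e : ∀ s, ‖F s - F r‖ = √(2 * (φ 0).re - 2 * (φ (r - s)).re) := by
    intro s
    rw [← Real.sqrt_sq (norm_nonneg _), @norm_sub_sq ℂ, ← @inner_self_eq_norm_sq ℂ,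
      ← @inner_self_eq_norm_sq ℂ, h, h, h, sub_self, sub_self]
    congr 1
    simp only [RCLike.re_to_complex]; ring
  simp only [e]
  have : Continuous fun s => √(2 * (φ 0).re - 2 * (φ (r - s)).re) := by fun_prop
  simpa using this.tendsto r

lemma integral_nonneg_of_kernel {X : Type*} {k : ℝ → X → X → ℂ}
    (hk : (Matrix.of fun a b : X × ℝ => k (b.2 - a.2) a.1 b.1).PosSemidef) {c : X →₀ ℂ}
    (hφ : Integrable fun t => ∑ p ∈ c.support, ∑ q ∈ c.support, star (c p) * k t p q * c q)
    (hφc : Continuous fun t => ∑ p ∈ c.support, ∑ q ∈ c.support, star (c p) * k t p q * c q) :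
    0 ≤ ∫ t, ∑ p ∈ c.support, ∑ q ∈ c.support, star (c p) * k t p q * c q := by
  let Kt : Matrix (X × ℝ) (X × ℝ) (ℂ →L[ℂ] ℂ) := Matrix.of fun a b =>
    (Matrix.of fun a b : X × ℝ => k (b.2 - a.2) a.1 b.1) a b • (1 : ℂ →L[ℂ] ℂ)
  have : Fact Kt.PosSemidef := ⟨posSemidef_smul_one hk⟩
  have hv : ∀ a b : X × ℝ, ⟪RKHS.kerFun (RKHS.OfKernel Kt) a 1,
      RKHS.kerFun (RKHS.OfKernel Kt) b 1⟫_ℂ = k (b.2 - a.2) a.1 b.1 := by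
    intro a b
    rw [RKHS.kerFun_inner, RKHS.kerFun_apply, RKHS.OfKernel.kernel_ofKernel]
    simp [Kt]
  have hF : ∀ r s, ⟪∑ p ∈ c.support, c p • RKHS.kerFun (RKHS.OfKernel Kt) (p, r) (1 : ℂ),
      ∑ p ∈ c.support, c p • RKHS.kerFun (RKHS.OfKernel Kt) (p, s) (1 : ℂ)⟫_ℂ
      = ∑ p ∈ c.support, ∑ q ∈ c.support, star (c p) * k (s - r) p q * c q := by
    intro r s
    rw [sum_inner]
    refine Finset.sum_congr rfl fun p _ => ?_
    rw [inner_sum]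
    refine Finset.sum_congr rfl fun q _ => ?_
    rw [inner_smul_left, inner_smul_right, hv, RCLike.star_def]
    ring
  exact integral_nonneg_of_gram (continuous_of_gram hφc hF) hφ hF

/-- The kernel `<f, g> ↦ e^{<f, g>} 1` of exponential vectors. -/
abbrev fockKernel (HS h : Type*) [NormedAddCommGroup HS] [InnerProductSpace ℂ HS]
    [CompleteSpace HS] [NormedAddCommGroup h] [InnerProductSpace ℂ h] :
    Matrix h h (HS →L[ℂ] HS) :=
  Matrix.of fun f g => Complex.exp ⟪f, g⟫_ℂ • (1 : HS →L[ℂ] HS)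

instance (HS h : Type*) [NormedAddCommGroup HS] [InnerProductSpace ℂ HS]
    [CompleteSpace HS] [NormedAddCommGroup h] [InnerProductSpace ℂ h] :
    Fact (fockKernel HS h).PosSemidef := ⟨posSemidef_smul_one posSemidef_exp⟩

/-- `HS ⊗ F(h)`, with `F(h)` the Boson Fock space over `h`: the Hilbert space spanned by the vectors
`u ⊗ ψ(f)` with `<u ⊗ ψ(f), v ⊗ ψ(g)> = <u, v> e^{<f, g>}`, `ψ(f)` the exponential vectors. -/
abbrev Fock (HS h : Type*) [NormedAddCommGroup HS] [InnerProductSpace ℂ HS]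
    [CompleteSpace HS] [NormedAddCommGroup h] [InnerProductSpace ℂ h] :=
  RKHS.OfKernel (fockKernel HS h)

/-- The map `u ↦ u ⊗ ψ(f)`. -/
def expVec {HS h : Type*} [NormedAddCommGroup HS] [InnerProductSpace ℂ HS]
    [CompleteSpace HS] [NormedAddCommGroup h] [InnerProductSpace ℂ h] (f : h) :
    HS →L[ℂ] Fock HS h := RKHS.kerFun (Fock HS h) f

lemma inner_expVec {HS h : Type*} [NormedAddCommGroup HS] [InnerProductSpace ℂ HS]
    [CompleteSpace HS] [NormedAddCommGroup h] [InnerProductSpace ℂ h] (f g : h) (u v : HS) :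
    ⟪expVec f u, expVec g v⟫_ℂ = Complex.exp ⟪f, g⟫_ℂ * ⟪u, v⟫_ℂ := by
  rw [expVec, expVec, RKHS.kerFun_inner, RKHS.kerFun_apply, RKHS.OfKernel.kernel_ofKernel]
  simp [inner_smul_right]

/-- Multiplication by a bounded measurable function on `L²(ℝᵈ)`. -/
def mulOp {d : ℕ} (m : EuclideanSpace ℝ (Fin d) → ℂ) (hm : Measurable m)
    (hb : ∃ C : ℝ, ∀ k, ‖m k‖ ≤ C) :
    Lp ℂ 2 (volume : Measure (EuclideanSpace ℝ (Fin d))) →L[ℂ]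
      Lp ℂ 2 (volume : Measure (EuclideanSpace ℝ (Fin d))) :=
  (ContinuousLinearMap.mul ℂ ℂ).holderL volume ⊤ 2 2
    ((memLp_top_of_bound hm.aestronglyMeasurable hb.choose
      (Eventually.of_forall hb.choose_spec)).toLp m)

lemma mulOp_coe {d : ℕ} (m : EuclideanSpace ℝ (Fin d) → ℂ) (hm : Measurable m)
    (hb : ∃ C : ℝ, ∀ k, ‖m k‖ ≤ C)
    (f : Lp ℂ 2 (volume : Measure (EuclideanSpace ℝ (Fin d)))) :
    mulOp m hm hb f =ᵐ[volume] fun k => m k * f k := by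
  have h1 := (ContinuousLinearMap.mul ℂ ℂ).coeFn_holder (r := 2) 
    ((memLp_top_of_bound (μ := volume) hm.aestronglyMeasurable hb.choose
      (Eventually.of_forall hb.choose_spec)).toLp m) f
  filter_upwards [h1, MemLp.coeFn_toLp (memLp_top_of_bound (μ := volume) hm.aestronglyMeasurable hb.choose
      (Eventually.of_forall hb.choose_spec))] with k h1 h2
  rw [mulOp]
  simp only [ContinuousLinearMap.holderL_apply_apply]
  rw [h1, h2]; rfl


/-- The one-particle space `L²(ℝᵈ)`. -/
abbrev OneParticle (d : ℕ) := Lp ℂ 2 (volume : Measure (EuclideanSpace ℝ (Fin d)))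

/-- `e^{itH₁}`, where `H₁` is multiplication by `ω`. -/
def freeGroup {d : ℕ} (ω : EuclideanSpace ℝ (Fin d) → ℝ) (hω : Measurable ω) (t : ℝ) :
    OneParticle d →L[ℂ] OneParticle d :=
  mulOp (fun k => exp (t * ω k * I)) (by fun_prop)
    ⟨1, fun k => by rw [← ofReal_mul, norm_exp_ofReal_mul_I]⟩

/-- `L = e^{-βH₁/2}`, where `H₁` is multiplication by `ω`. -/
def gibbsRoot {d : ℕ} (ω : EuclideanSpace ℝ (Fin d) → ℝ) (hω : Measurable ω)
    (hb : BddBelow (Set.range ω)) (β : ℝ) (hβ : 0 < β) :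
    OneParticle d →L[ℂ] OneParticle d :=
  mulOp (fun k => (Real.exp (-β * ω k / 2) : ℂ)) (by fun_prop) (by
    obtain ⟨c, hc⟩ := hb
    refine ⟨Real.exp (-β * c / 2), fun k => ?_⟩
    rw [Complex.norm_real, Real.norm_eq_abs, Real.abs_exp]
    have : c ≤ ω k := hc ⟨k, rfl⟩
    exact Real.exp_le_exp.2 (by nlinarith))

/-- `S_t = e^{it(H₁ - ω₀P₀)} = e^{itH₁} e^{-itω₀P₀}` for a projection `P₀` commuting with `H₁`. -/
def modifiedGroup {d : ℕ} (ω : EuclideanSpace ℝ (Fin d) → ℝ) (hω : Measurable ω) (ω₀ : ℝ)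
    (P₀ : OneParticle d →L[ℂ] OneParticle d) (t : ℝ) : OneParticle d →L[ℂ] OneParticle d :=
  freeGroup ω hω t ∘L (1 + (exp (-(t * ω₀) * I) - 1) • P₀)

/-- The data of the low density model: a system with Hilbert space `HS` coupled to a Bose gas with
one-particle space `L²(ℝᵈ)` by the interaction `D ⊗ A⁺(g₀) A(g₁) + D⁺ ⊗ A⁺(g₁) A(g₀)`, at inverse
temperature `β`. -/
structure Model (d : ℕ) (HS : Type*) [NormedAddCommGroup HS] [InnerProductSpace ℂ HS]
    [CompleteSpace HS] where
  /-- The one-particle Hamiltonian `H₁` is multiplication by the dispersion law `ω`. -/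
  ω : EuclideanSpace ℝ (Fin d) → ℝ
  measurable_ω : Measurable ω
  bddBelow_ω : BddBelow (Set.range ω)
  /-- inverse temperature -/
  β : ℝ
  β_pos : 0 < β
  /-- the system operator `D` of the interaction -/
  D₀ : HS →L[ℂ] HS
  /-- the frequency of the rotating wave condition `e^{itH_S} D e^{-itH_S} = e^{-itω₀} D` -/
  ω₀ : ℝ
  /-- an orthogonal projection commuting with the free one-particle dynamics, which separates the
  two form-factors -/
  P₀ : OneParticle d →L[ℂ] OneParticle d
  isStarProjection_P₀ : IsStarProjection P₀
  P₀_comm : ∀ t, P₀ ∘L freeGroup ω measurable_ω t = freeGroup ω measurable_ω t ∘L P₀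
  P₀_comm_gibbs : P₀ ∘L gibbsRoot ω measurable_ω bddBelow_ω β β_pos =
    gibbsRoot ω measurable_ω bddBelow_ω β β_pos ∘L P₀
  /-- the form-factors `g₀, g₁` -/
  g : Fin 2 → OneParticle d
  P₀_g_zero : P₀ (g 0) = g 0
  P₀_g_one : P₀ (g 1) = 0
  /-- The space of test vectors on which the correlations are integrable in time. It lies in the
  closed span of the vectors `S_t g_ε`. -/
  K : Submodule ℂ (OneParticle d)
  g_mem : ∀ ε, g ε ∈ K
  K_le : K ≤ (Submodule.span ℂ
    {x | ∃ t ε, x = modifiedGroup ω measurable_ω ω₀ P₀ t (g ε)}).topologicalClosure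
  integrable_K : ∀ x ∈ K, ∀ y ∈ K,
    Integrable fun t : ℝ => ⟪x, modifiedGroup ω measurable_ω ω₀ P₀ t y⟫_ℂ
  /-- the same with `L² = e^{-βH₁}`, so that the spectral densities `<x, P_E L² y>` exist -/
  integrable_K_gibbs : ∀ x ∈ K, ∀ y ∈ K, Integrable fun t : ℝ =>
    ⟪x, modifiedGroup ω measurable_ω ω₀ P₀ t (gibbsRoot ω measurable_ω bddBelow_ω β β_pos
      (gibbsRoot ω measurable_ω bddBelow_ω β β_pos y))⟫_ℂ

lemma inner_mulOp {d : ℕ} (m : EuclideanSpace ℝ (Fin d) → ℂ) (hm : Measurable m)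
    (hb : ∃ C : ℝ, ∀ k, ‖m k‖ ≤ C) (f g : OneParticle d) :
    ⟪f, mulOp m hm hb g⟫_ℂ = ∫ k, m k * (conj (f k) * g k) := by
  rw [L2.inner_def]
  refine integral_congr_ae ?_
  filter_upwards [mulOp_coe m hm hb g] with k hk
  rw [hk, RCLike.inner_apply]; ring

lemma mulOp_comp {d : ℕ} (m m' : EuclideanSpace ℝ (Fin d) → ℂ) (hm : Measurable m)
    (hb : ∃ C : ℝ, ∀ k, ‖m k‖ ≤ C) (hm' : Measurable m') (hb' : ∃ C : ℝ, ∀ k, ‖m' k‖ ≤ C)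
    (f : OneParticle d) :
    (mulOp m hm hb (mulOp m' hm' hb' f) : EuclideanSpace ℝ (Fin d) → ℂ)
      =ᵐ[volume] fun k => m k * (m' k * f k) := by
  filter_upwards [mulOp_coe m hm hb (mulOp m' hm' hb' f), mulOp_coe m' hm' hb' f] with k h1 h2
  rw [h1, h2]

lemma inner_mulOp_left {d : ℕ} (m m' : EuclideanSpace ℝ (Fin d) → ℂ) (hm : Measurable m)
    (hb : ∃ C : ℝ, ∀ k, ‖m k‖ ≤ C) (hm' : Measurable m') (hb' : ∃ C : ℝ, ∀ k, ‖m' k‖ ≤ C)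
    (hc : ∀ k, m' k = conj (m k)) (f g : OneParticle d) :
    ⟪mulOp m hm hb f, g⟫_ℂ = ⟪f, mulOp m' hm' hb' g⟫_ℂ := by
  rw [L2.inner_def, L2.inner_def]
  refine integral_congr_ae ?_
  filter_upwards [mulOp_coe m hm hb f, mulOp_coe m' hm' hb' g] with k h1 h2
  rw [h1, h2, hc, RCLike.inner_apply, RCLike.inner_apply, map_mul]; ring

lemma freeGroup_add {d : ℕ} (ω : EuclideanSpace ℝ (Fin d) → ℝ) (hω : Measurable ω) (s t : ℝ) :
    freeGroup ω hω (s + t) = freeGroup ω hω s ∘L freeGroup ω hω t := by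
  ext f : 1
  refine Lp.ext ?_
  simp only [ContinuousLinearMap.comp_apply, freeGroup]
  refine (mulOp_coe _ _ _ f).trans (EventuallyEq.trans ?_ (mulOp_comp _ _ _ _ _ _ f).symm)
  refine Eventually.of_forall fun k => ?_
  simp only
  rw [← mul_assoc, ← Complex.exp_add]
  congr 2
  push_cast; ring

lemma inner_freeGroup {d : ℕ} (ω : EuclideanSpace ℝ (Fin d) → ℝ) (hω : Measurable ω) (t : ℝ)
    (f g : OneParticle d) : ⟪freeGroup ω hω t f, g⟫_ℂ = ⟪f, freeGroup ω hω (-t) g⟫_ℂ := by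
  refine inner_mulOp_left _ _ _ _ _ _ (fun k => ?_) f g
  rw [← Complex.exp_conj]
  simp

lemma continuous_inner_freeGroup {d : ℕ} (ω : EuclideanSpace ℝ (Fin d) → ℝ) (hω : Measurable ω)
    (f g : OneParticle d) : Continuous fun t => ⟪f, freeGroup ω hω t g⟫_ℂ := by
  simp only [freeGroup, inner_mulOp]
  have hint : Integrable fun k => conj (f k) * g k := by
    have := L2.integrable_inner (𝕜 := ℂ) f g
    refine this.congr (Eventually.of_forall fun k => ?_)
    simp only [RCLike.inner_apply]; ring
  refine continuous_of_dominated (bound := fun k => ‖conj (f k) * g k‖) (fun t => ?_) (fun t => ?_)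
    hint.norm ?_
  · exact Measurable.aestronglyMeasurable (by fun_prop) |>.mul hint.1
  · refine Eventually.of_forall fun k => ?_
    rw [norm_mul, ← ofReal_mul, norm_exp_ofReal_mul_I, one_mul]
  · refine Eventually.of_forall fun k => ?_
    fun_prop

namespace Model

variable {d : ℕ} {HS : Type*} [NormedAddCommGroup HS] [InnerProductSpace ℂ HS] [CompleteSpace HS]
  (M : Model d HS)

/-- The group `S_t`. -/
def S (t : ℝ) : OneParticle d →L[ℂ] OneParticle d :=
  modifiedGroup M.ω M.measurable_ω M.ω₀ M.P₀ t

/-- `L = e^{-βH₁/2}`. -/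
def L : OneParticle d →L[ℂ] OneParticle d :=
  gibbsRoot M.ω M.measurable_ω M.bddBelow_ω M.β M.β_pos

lemma inner_P₀ (f g : OneParticle d) : ⟪M.P₀ f, g⟫_ℂ = ⟪f, M.P₀ g⟫_ℂ := by
  have := M.isStarProjection_P₀.isSelfAdjoint
  rw [ContinuousLinearMap.isSelfAdjoint_iff'] at this
  nth_rewrite 2 [← this]
  rw [ContinuousLinearMap.adjoint_inner_right]

lemma S_apply (t : ℝ) (f : OneParticle d) : M.S t f =
    freeGroup M.ω M.measurable_ω t (f + (exp (-(t * M.ω₀) * I) - 1) • M.P₀ f) := by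
  simp [S, modifiedGroup]

lemma inner_S_S (r s : ℝ) (f g : OneParticle d) : ⟪M.S r f, M.S s g⟫_ℂ = ⟪f, M.S (s - r) g⟫_ℂ := by
  have hP : ∀ t h, M.P₀ (freeGroup M.ω M.measurable_ω t h)
      = freeGroup M.ω M.measurable_ω t (M.P₀ h) := fun t h => by
    simpa using congrArg (fun A => A h) (M.P₀_comm t)
  have hPP : ∀ h, M.P₀ (M.P₀ h) = M.P₀ h := fun h => by
    simpa using congrArg (fun A => A h) M.isStarProjection_P₀.isIdempotentElem.eq
  have hg : ∀ h, freeGroup M.ω M.measurable_ω (-r) (freeGroup M.ω M.measurable_ω s h)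
      = freeGroup M.ω M.measurable_ω (s - r) h := fun h => by
    rw [show s - r = -r + s by ring, freeGroup_add]; rfl
  have he : exp (-(((s - r : ℝ) : ℂ) * M.ω₀) * I)
      = exp (-(s * M.ω₀) * I) * conj (exp (-(r * M.ω₀) * I)) := by
    rw [← Complex.exp_conj, ← Complex.exp_add]
    congr 1
    simp; ring
  rw [S_apply, S_apply, S_apply, inner_freeGroup, hg, he, inner_add_left, inner_smul_left,
    inner_P₀, hP]
  simp only [map_add, map_smul, hPP, inner_add_right, inner_smul_right, map_sub, map_one]
  ring

lemma continuous_inner_S (f g : OneParticle d) : Continuous fun t => ⟪f, M.S t g⟫_ℂ := by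
  simp only [S_apply, map_add, map_smul, inner_add_right, inner_smul_right]
  exact (continuous_inner_freeGroup _ _ f g).add
    ((by fun_prop : Continuous fun t : ℝ => exp (-(t * M.ω₀) * I) - 1).mul
      (continuous_inner_freeGroup _ _ f _))

lemma S_L (t : ℝ) (f : OneParticle d) : M.S t (M.L f) = M.L (M.S t f) := by
  have hP : ∀ h, M.P₀ (M.L h) = M.L (M.P₀ h) := fun h => by
    exact congrArg (fun A => A h) M.P₀_comm_gibbs
  have hF : ∀ h, freeGroup M.ω M.measurable_ω t (M.L h)
      = M.L (freeGroup M.ω M.measurable_ω t h) := fun h => by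
    refine Lp.ext ?_
    simp only [freeGroup, L, gibbsRoot]
    refine (mulOp_comp _ _ _ _ _ _ h).trans (EventuallyEq.trans ?_ (mulOp_comp _ _ _ _ _ _ h).symm)
    exact Eventually.of_forall fun k => by ring
  rw [S_apply, S_apply, hP, ← map_smul, ← map_add, hF]

lemma inner_L (f g : OneParticle d) : ⟪M.L f, g⟫_ℂ = ⟪f, M.L g⟫_ℂ := by
  unfold L gibbsRoot
  refine inner_mulOp_left _ _ _ _ _ _ (fun k => by
    exact (Complex.conj_ofReal _).symm) f g

lemma S_zero (f : OneParticle d) : M.S 0 f = f := by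
  rw [S_apply]
  simp only [ofReal_zero, zero_mul, neg_zero, Complex.exp_zero, sub_self, zero_smul, add_zero]
  refine Lp.ext ?_
  rw [freeGroup]
  refine (mulOp_coe _ _ _ f).trans (Eventually.of_forall fun k => ?_)
  simp

lemma inner_S_L_L (t : ℝ) (x y : OneParticle d) :
    ⟪x, M.S t (M.L (M.L y))⟫_ℂ = ⟪M.L x, M.S t (M.L y)⟫_ℂ := by
  rw [inner_L, S_L M t (M.L y)]

/-- `<p₁, S_t q₁>` times the conjugate of `<p₂, S_t L² q₂>`. -/
def pairCorr (t : ℝ) (p q : M.K × M.K) : ℂ :=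
  ⟪(p.1 : OneParticle d), M.S t q.1⟫_ℂ * conj ⟪(p.2 : OneParticle d), M.S t (M.L (M.L q.2))⟫_ℂ

lemma integrable_pairCorr (p q : M.K × M.K) : Integrable fun t => M.pairCorr t p q := by
  have h1 : Integrable fun t => ⟪(p.1 : OneParticle d), M.S t q.1⟫_ℂ :=
    M.integrable_K _ p.1.2 _ q.1.2
  refine h1.mul_bdd (c := ‖M.L (p.2 : OneParticle d)‖ * ‖M.L (q.2 : OneParticle d)‖) ?_ ?_
  · exact (Complex.continuous_conj.comp (M.continuous_inner_S _ _)).aestronglyMeasurable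
  · refine Eventually.of_forall fun t => ?_
    rw [RCLike.norm_conj, inner_S_L_L]
    refine (norm_inner_le_norm _ _).trans_eq ?_
    congr 1
    have := M.inner_S_S t t (M.L q.2) (M.L q.2)
    rw [sub_self] at this
    rw [S_zero, inner_self_eq_norm_sq_to_K, inner_self_eq_norm_sq_to_K] at this
    exact (sq_eq_sq₀ (norm_nonneg _) (norm_nonneg _)).1 (by exact_mod_cast this)

lemma continuous_pairCorr (p q : M.K × M.K) : Continuous fun t => M.pairCorr t p q :=
  (M.continuous_inner_S _ _).mul (Complex.continuous_conj.comp (M.continuous_inner_S _ _))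

lemma posSemidef_pairCorr_time :
    (Matrix.of fun a b : (M.K × M.K) × ℝ => M.pairCorr (b.2 - a.2) a.1 b.1).PosSemidef := by
  have h1 := posSemidef_gramKernel (fun a : (M.K × M.K) × ℝ => M.S a.2 a.1.1)
  have h2 := (posSemidef_gramKernel (fun a : (M.K × M.K) × ℝ => M.S a.2 (M.L a.1.2))).transpose
  have e : (Matrix.of fun a b : (M.K × M.K) × ℝ => M.pairCorr (b.2 - a.2) a.1 b.1) =
      Matrix.hadamard (Matrix.of fun a b : (M.K × M.K) × ℝ => ⟪M.S a.2 a.1.1, M.S b.2 b.1.1⟫_ℂ)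
      (Matrix.transpose (Matrix.of fun a b : (M.K × M.K) × ℝ =>
        ⟪M.S a.2 (M.L a.1.2), M.S b.2 (M.L b.1.2)⟫_ℂ)) := by
    ext a b
    simp only [Matrix.of_apply, Matrix.hadamard_apply, Matrix.transpose_apply, pairCorr,
      inner_S_L_L, inner_S_S]
    congr 1
    rw [← inner_S_S, ← inner_S_S, inner_conj_symm]
  rw [e]
  exact h1.hadamard h2

lemma posSemidef_pairKernel :
    (Matrix.of fun p q : M.K × M.K => ∫ t, M.pairCorr t p q).PosSemidef := by
  refine ⟨?_, fun c => ?_⟩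
  · ext p q
    rw [Matrix.conjTranspose_apply, Matrix.of_apply, Matrix.of_apply, RCLike.star_def,
      ← integral_conj, ← integral_neg_eq_self]
    refine integral_congr_ae (Eventually.of_forall fun t => ?_)
    have h : ∀ x y, conj ⟪x, M.S (-t) y⟫_ℂ = ⟪y, M.S t x⟫_ℂ := fun x y => by
      rw [inner_conj_symm]
      have := M.inner_S_S (-t) 0 y x
      rw [S_zero] at this
      simpa using this
    simp only [pairCorr, map_mul, inner_S_L_L, h]
  · let φ : ℝ → ℂ := fun t => ∑ p ∈ c.support, ∑ q ∈ c.support,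
      star (c p) * M.pairCorr t p q * c q
    have hφ : Integrable φ := integrable_finsetSum _ fun p _ => integrable_finsetSum _ fun q _ =>
      ((M.integrable_pairCorr p q).const_mul _).mul_const _
    have hφc : Continuous φ := continuous_finsetSum _ fun p _ => continuous_finsetSum _ fun q _ =>
      ((M.continuous_pairCorr p q).const_mul _).mul_const _
    have hint : ∫ t, φ t = c.sum fun p a => c.sum fun q b =>
        star a * (Matrix.of fun p q : M.K × M.K => ∫ t, M.pairCorr t p q) p q * b := by
      simp only [φ, Finsupp.sum]
      rw [integral_finsetSum _ fun p _ => integrable_finsetSum _ fun q _ =>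
        ((M.integrable_pairCorr p q).const_mul _).mul_const _]
      refine Finset.sum_congr rfl fun p _ => ?_
      rw [integral_finsetSum _ fun q _ =>
        ((M.integrable_pairCorr p q).const_mul _).mul_const _]
      refine Finset.sum_congr rfl fun q _ => ?_
      rw [integral_mul_const, integral_const_mul, Matrix.of_apply]
    rw [← hint]
    exact integral_nonneg_of_kernel M.posSemidef_pairCorr_time hφ hφc

/-- The Gram kernel of the vectors `x ⊗_β y`, namely
`(x ⊗_β y | x₁ ⊗_β y₁) = ∫ <x, S_t x₁> conj <y, S_t L² y₁> dt`. -/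
abbrev pairKernel : Matrix (M.K × M.K) (M.K × M.K) (ℂ →L[ℂ] ℂ) :=
  Matrix.of fun p q =>
    (Matrix.of fun p q : M.K × M.K => ∫ t, M.pairCorr t p q) p q • (1 : ℂ →L[ℂ] ℂ)

instance : Fact M.pairKernel.PosSemidef := ⟨posSemidef_smul_one M.posSemidef_pairKernel⟩

/-- The Hilbert space `K ⊗_β K`: the completion, modulo null vectors, of the finite linear
combinations of symbols `x ⊗_β y` for the scalar product given by `pairKernel`. The tensor
relations (linear in `x`, antilinear in `y`) hold because they are null vectors. -/
abbrev PairSpace := RKHS.OfKernel M.pairKernel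

/-- The vector `x ⊗_β y`. -/
def pairVec (x y : M.K) : M.PairSpace := RKHS.kerFun M.PairSpace (x, y) 1

lemma inner_pairVec (x y x₁ y₁ : M.K) : ⟪M.pairVec x y, M.pairVec x₁ y₁⟫_ℂ =
    ∫ t, ⟪(x : OneParticle d), M.S t x₁⟫_ℂ * conj ⟪(y : OneParticle d), M.S t (M.L (M.L y₁))⟫_ℂ := by
  rw [pairVec, pairVec, RKHS.kerFun_inner, RKHS.kerFun_apply, RKHS.OfKernel.kernel_ofKernel]
  simp [pairCorr]

/-- The one-particle space `L²(ℝ) ⊗ (K ⊗_β K) = L²(ℝ; K ⊗_β K)` of the white noise. -/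
abbrev NoiseSpace := Lp M.PairSpace 2 (volume : Measure ℝ)

/-- `H_S ⊗ F(L²(ℝ) ⊗ (K ⊗_β K))`, the state space of the limiting dynamics. -/
abbrev StateSpace := Fock HS M.NoiseSpace

/-- Test functions `f(s) = ∑ⱼ φⱼ(s) xⱼ ⊗_β yⱼ` with `φⱼ` continuous of compact support and
`xⱼ, yⱼ ∈ K`, given by the list of the `(φⱼ, xⱼ, yⱼ)`. -/
abbrev TestFn := List (C_c(ℝ, ℂ) × M.K × M.K)

/-- The value at time `s` of a test function. -/
def TestFn.eval {M : Model d HS} (f : M.TestFn) (s : ℝ) : M.PairSpace :=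
  (f.map fun z => z.1 s • M.pairVec z.2.1 z.2.2).sum

lemma TestFn.memLp {M : Model d HS} (f : M.TestFn) :
    MemLp (TestFn.eval f) 2 (volume : Measure ℝ) := by
  induction f with
  | nil => exact MemLp.zero
  | cons z f ih =>
    have h1 : MemLp (fun s => z.1 s • M.pairVec z.2.1 z.2.2) 2 (volume : Measure ℝ) := by
      refine Continuous.memLp_of_hasCompactSupport (by fun_prop) ?_
      exact z.1.hasCompactSupport.smul_right
    have e : TestFn.eval (z :: f) =
        (fun s => z.1 s • M.pairVec z.2.1 z.2.2) + TestFn.eval f := by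
      ext1 s; simp [TestFn.eval]
    rw [e]
    exact h1.add ih

/-- A test function as an element of the noise space. -/
def TestFn.toNoise {M : Model d HS} (f : M.TestFn) : M.NoiseSpace := (TestFn.memLp f).toLp _

/-- Quadratic forms on `H_S ⊗ span {ψ(f)}`, `ψ(f)` the exponential vectors of test functions: to
`f, f₁` is attached the operator on `H_S` whose matrix elements are `<u ⊗ ψ(f), X (v ⊗ ψ(f₁))>`. -/
abbrev Form := M.TestFn → M.TestFn → (HS →L[ℂ] HS)

/-- The form of a bounded operator on the state space. -/
def toForm (A : M.StateSpace →L[ℂ] M.StateSpace) : M.Form := fun f f₁ =>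
  ContinuousLinearMap.adjoint (expVec (TestFn.toNoise f)) ∘L A ∘L expVec (TestFn.toNoise f₁)

lemma inner_toForm (A : M.StateSpace →L[ℂ] M.StateSpace) (f f₁ : M.TestFn) (u v : HS) :
    ⟪u, M.toForm A f f₁ v⟫_ℂ =
      ⟪expVec (TestFn.toNoise f) u, A (expVec (TestFn.toNoise f₁) v)⟫_ℂ := by
  simp [toForm, ContinuousLinearMap.adjoint_inner_right]

/-- `A ⊗ 1` times a form. -/
def sysMul (A : HS →L[ℂ] HS) (X : M.Form) : M.Form := fun f f₁ => A ∘L X f f₁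

/-- `D_ε`: `D_0 = D`, `D_1 = D⁺`. -/
def D (ε : Fin 2) : HS →L[ℂ] HS := ![M.D₀, ContinuousLinearMap.adjoint M.D₀] ε

/-- The spectral density `<x, P_E y> = (2π)⁻¹ ∫ <x, S_t y> e^{-itE} dt`. -/
def specDensity (x y : OneParticle d) (E : ℝ) : ℂ :=
  (2 * Real.pi : ℂ)⁻¹ * ∫ t : ℝ, ⟪x, M.S t y⟫_ℂ * exp (-(t * E) * I)

/-- `γ_ε(E) = ∫_{-∞}^0 <g_ε, S_t g_ε> e^{-itE} dt`. -/
def γ (ε : Fin 2) (E : ℝ) : ℂ :=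
  ∫ t in Set.Iic (0 : ℝ), ⟪M.g ε, M.S t (M.g ε)⟫_ℂ * exp (-(t * E) * I)

/-- `n_ε(E) = 1 / <g_ε, P_E L² g_ε>`. Where the denominator vanishes, the noises `B_{a,ε}(E, t)`
vanish too, so that the value there is immaterial. -/
def n (ε : Fin 2) (E : ℝ) : ℂ := 1 / M.specDensity (M.g ε) (M.L (M.L (M.g ε))) E

/-- `T_ε(E) = (1 + γ_ε(E) γ_{1-ε}(E) D_ε D_{1-ε})⁻¹` (meaningful if the inverse exists). -/
def T (ε : Fin 2) (E : ℝ) : HS →L[ℂ] HS :=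
  Ring.inverse (1 + (M.γ ε E * M.γ (1 - ε) E) • (M.D ε * M.D (1 - ε)))

/-- The eigenvalue `(g_a ⊗_β P_E g_b | f(t))` of `B_{a,b}(E, t) = b_t(g_a ⊗_β P_E g_b)` on the
exponential vector of `f`. For `f(t) = x ⊗_β y` it is
`∫ <g_a, S_r x> conj <P_E g_b, S_r L² y> dr = 2π <g_a, P_E x> conj <g_b, P_E L² y>`. -/
def amp (a b : Fin 2) (E t : ℝ) (f : M.TestFn) : ℂ :=
  (f.map fun z => z.1 t * ((2 * Real.pi : ℂ) * M.specDensity (M.g a) z.2.1 E *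
    conj (M.specDensity (M.g b) (M.L (M.L z.2.2)) E))).sum

/-- The form `B⁺_{a,b}(E, t) X`. -/
def creMul (a b : Fin 2) (E t : ℝ) (X : M.Form) : M.Form :=
  fun f f₁ => conj (M.amp a b E t f) • X f f₁

/-- The form `X B_{a,b}(E, t)`. -/
def mulAnn (a b : Fin 2) (E t : ℝ) (X : M.Form) : M.Form :=
  fun f f₁ => M.amp a b E t f₁ • X f f₁

/-- The commutator, before the limit `l → 0`, of the rescaled noises
`B_{a,b}(E, t) = ∫ B_{a,b}(E₁, E, t) dE₁` and `B⁺_{c,e}(E, s)`, `τ = s - t`, up to the energy delta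
function: `∫ l⁻² e^{iτ(E₁ - E)/l²} <g_a, P_{E₁} g_c> conj <g_b, P_E L² g_e> dE₁`. -/
def preComm (l : ℝ) (a b c e : Fin 2) (E τ : ℝ) : ℂ :=
  ((l ^ 2)⁻¹ : ℝ) * ⟪M.g a, M.S (τ / l ^ 2) (M.g c)⟫_ℂ * exp (-((τ / l ^ 2 : ℝ) * E) * I) *
    conj (M.specDensity (M.g b) (M.L (M.L (M.g e))) E)

/-- Let the process `U` have white noise derivative
`∂_s U_s = ∑_{c,e} ∫ B⁺_{c,e}(E, s) C_{c,e}(E, s) dE + ...`, where the dots and the `C_{c,e}(E, s)`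
contain no further creators at time `s` to the left. Then `X` is the causal product
`B_{a,b}(E, t) U_t`: it is the normally ordered product `U_t B_{a,b}(E, t)` plus the commutator
`∫_0^t [B_{a,b}(E, t), ∂_s U_s] ds`, in which the commutator of the noises is the limit
(as a distribution on `s ≤ t`) of `preComm`. -/
def IsCausalProduct (U : ℝ → M.StateSpace →L[ℂ] M.StateSpace)
    (C : Fin 2 → Fin 2 → ℝ → ℝ → M.Form) (a b : Fin 2) (E t : ℝ) (X : M.Form) : Prop :=
  ∀ f f₁, Tendsto (fun l : ℝ => M.mulAnn a b E t (M.toForm (U t)) f f₁ +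
      ∫ s in (0 : ℝ)..t, ∑ c, ∑ e, M.preComm l a b c e E (s - t) • C c e E s f f₁)
    (𝓝[>] 0) (𝓝 (X f f₁))

/-- The integrand `∑_e n_e(E) B⁺_{a,e}(E, t) B_{c,e}(E, t) U_t` of `N_{a,c}(t) U_t`, where
`BU a b E t` stands for the form `B_{a,b}(E, t) U_t`. -/
def numberDensity (BU : Fin 2 → Fin 2 → ℝ → ℝ → M.Form) (a c : Fin 2) (E t : ℝ) : M.Form :=
  ∑ e, M.n e E • M.creMul a e E t (BU c e E t)

/-- `N_{a,c}(t) U_t = ∫ ∑_e n_e(E) B⁺_{a,e}(E, t) B_{c,e}(E, t) U_t dE`. -/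
def numberAct (BU : Fin 2 → Fin 2 → ℝ → ℝ → M.Form) (a c : Fin 2) (t : ℝ) : M.Form :=
  fun f f₁ => ∫ E, M.numberDensity BU a c E t f f₁

/-- `H(t) U_t = ∑_ε D_ε ⊗ (N_{ε,1-ε}(t) + B_{1-ε,ε}(t) + B⁺_{ε,1-ε}(t)) U_t`. -/
def hamiltonianAct (U : ℝ → M.StateSpace →L[ℂ] M.StateSpace)
    (BU : Fin 2 → Fin 2 → ℝ → ℝ → M.Form) (t : ℝ) : M.Form :=
  ∑ ε, M.sysMul (M.D ε) fun f f₁ => M.numberAct BU ε (1 - ε) t f f₁ +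
    (∫ E, BU (1 - ε) ε E t f f₁) + ∫ E, M.creMul ε (1 - ε) E t (M.toForm (U t)) f f₁

/-- The coefficient of `B⁺_{c,e}(E, t)` in `-i H(t) U_t`, namely
`-i D_c (n_e(E) B_{1-c,e}(E, t) U_t + δ_{e,1-c} U_t)`. -/
def creCoeff (U : ℝ → M.StateSpace →L[ℂ] M.StateSpace)
    (BU : Fin 2 → Fin 2 → ℝ → ℝ → M.Form) (c e : Fin 2) (E t : ℝ) : M.Form :=
  (-I) • M.sysMul (M.D c)
    (M.n e E • BU (1 - c) e E t + if e = 1 - c then M.toForm (U t) else 0)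

/-- `U_t` acts only on the noise in the time interval `[0, t]`. -/
def IsAdapted (U : ℝ → M.StateSpace →L[ℂ] M.StateSpace) : Prop :=
  ∀ t, 0 ≤ t → ∀ f h f₁ h₁ : M.TestFn,
    (∀ s ∈ Set.Icc 0 t, TestFn.eval f s = TestFn.eval h s) →
    (∀ s ∈ Set.Icc 0 t, TestFn.eval f₁ s = TestFn.eval h₁ s) →
    exp (-⟪TestFn.toNoise f, TestFn.toNoise f₁⟫_ℂ) • M.toForm (U t) f f₁ =
      exp (-⟪TestFn.toNoise h, TestFn.toNoise h₁⟫_ℂ) • M.toForm (U t) h h₁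

/-- `U` is an evolution operator of the stochastic limit, that is a solution of the white noise
equation `∂_t U_t = -i H(t) U_t`, `U_0 = 1`, and `BU a b E t` is the product
`B_{a,b}(E, t) U_t` that occurs in it. -/
structure IsEvolution (U : ℝ → M.StateSpace →L[ℂ] M.StateSpace)
    (BU : Fin 2 → Fin 2 → ℝ → ℝ → M.Form) : Prop where
  initial : U 0 = 1
  adapted : M.IsAdapted U
  continuousOn : ∀ a b E f f₁, ContinuousOn (fun t => BU a b E t f f₁) (Set.Ici 0)
  /-- the energy integrals in `H(t) U_t` converge -/
  integrable_number : ∀ ε t, 0 ≤ t → ∀ f f₁,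
    Integrable fun E => M.numberDensity BU ε (1 - ε) E t f f₁
  integrable_ann : ∀ ε t, 0 ≤ t → ∀ f f₁, Integrable fun E => BU (1 - ε) ε E t f f₁
  integrable_cre : ∀ ε t, 0 ≤ t → ∀ f f₁,
    Integrable fun E => M.creMul ε (1 - ε) E t (M.toForm (U t)) f f₁
  /-- `U_t = 1 - i ∫_0^t H(s) U_s ds` -/
  intervalIntegrable : ∀ t, 0 ≤ t → ∀ f f₁,
    IntervalIntegrable (fun s => M.hamiltonianAct U BU s f f₁) volume 0 t
  integral_eq : ∀ t, 0 ≤ t → ∀ f f₁,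
    M.toForm (U t) f f₁ = M.toForm 1 f f₁ - I • ∫ s in (0 : ℝ)..t, M.hamiltonianAct U BU s f f₁
  /-- the products `B_{a,b}(E, t) U_t` are the causal ones -/
  causal : ∀ a b E t, 0 < t → M.IsCausalProduct U (M.creCoeff U BU) a b E t (BU a b E t)

/-- The integrand, at energy `E`, of the normally ordered form of `i D_ε N_{ε,1-ε}(t) U_t`:
`γ_{1-ε} D_ε D_{1-ε} T_ε (-i D_ε γ_ε B⁺_{ε,1-ε}(E, t) + B⁺_{ε,ε}(E, t)) U_t
  + ∑_e n_e (i T_ε D_ε B⁺_{ε,e}(E, t) U_t B_{1-ε,e}(E, t)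
    + γ_{1-ε} D_ε D_{1-ε} T_ε B⁺_{ε,e}(E, t) U_t B_{ε,e}(E, t))`. -/
def normallyOrdered (U : ℝ → M.StateSpace →L[ℂ] M.StateSpace) (ε : Fin 2) (t E : ℝ) : M.Form :=
  M.sysMul (M.γ (1 - ε) E • (M.D ε * M.D (1 - ε) * M.T ε E))
      (M.sysMul ((-I * M.γ ε E) • M.D ε) (M.creMul ε (1 - ε) E t (M.toForm (U t)))
        + M.creMul ε ε E t (M.toForm (U t)))
    + ∑ e, M.n e E •
      (M.sysMul (I • (M.T ε E * M.D ε))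
          (M.creMul ε e E t (M.mulAnn (1 - ε) e E t (M.toForm (U t))))
        + M.sysMul (M.γ (1 - ε) E • (M.D ε * M.D (1 - ε) * M.T ε E))
          (M.creMul ε e E t (M.mulAnn ε e E t (M.toForm (U t)))))

end Model
end LowDensity
end

/-!
The products `B_{a,e}(E, t) U_t` can be computed in closed form. The commutator of `B_{a,b}(E, t)`
with the creators in `∂_s U_s`, `s ≤ t`, rescaled by `λ⁻²` in time, is a one-sided delta family at
the end point `s = t` with weight `γ_a(E) <g_b, P_E L² g_b>` (`tendsto_integral_endpoint`). Here only
the creator `B⁺_{a,b}` survives, because `P₀` separates `g₀` from `g₁` and commutes with `S_t` and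
`L`. The matrix elements multiplying the delta family are continuous in `s`: for `B_{a,b}(E, s) U_s`
this is assumed, and for `U_s` it follows from the integral equation. Thus
`IsEvolution.causal_eq` expresses `B_{a,e} U_t` through `U_t B_{a,e}`, `U_t` and `B_{1-a,e} U_t`.

For fixed `E` and `e` the cases `a = 0, 1` of this identity form a linear system for the two unknowns
`B_{a,e}(E, t) U_t`, whose elimination produces the coefficient `1 + γ_ε γ_{1-ε} D_ε D_{1-ε}`,
inverted by `T_ε(E)` (`causal_system_solution`).

The spectral density `<g_e, P_E L² g_e>` in the commutator cancels against `n_e(E)` once the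
equation is multiplied by the eigenvalue of `B⁺_{a,e}(E, t)`. At energies where the density vanishes
this rests on the positivity of the form `<x, P_E L² y>`: by Cauchy–Schwarz the
eigenvalue vanishes there as well (`amp_eq_zero`). So the normally ordered integrand equals
`i D_ε` times the integrand of `N_{ε,1-ε}(t) U_t` at every energy, and its convergence is inherited
from that of `N_{ε,1-ε}(t) U_t`.
-/

namespace LowDensity

/-! ### One-sided delta families -/

/-- As `l → 0⁺` the kernels `l⁻² φ((s - t) / l²)` on `s ≤ t` converge to a delta function at the end
point `t`, of weight `∫_{-∞}^0 φ`. Substituting `s = t + l² r` turns this into dominated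
convergence. -/
lemma tendsto_integral_endpoint {V : Type*} [NormedAddCommGroup V] [NormedSpace ℂ V]
    [CompleteSpace V]
    {φ : ℝ → ℂ} (hφ : Integrable φ) {t : ℝ} (ht : 0 < t) {F : ℝ → V}
    (hF : ContinuousOn F (Set.Icc 0 t)) :
    Tendsto (fun l : ℝ => ∫ s in (0 : ℝ)..t, (((l ^ 2)⁻¹ : ℝ) * φ ((s - t) / l ^ 2)) • F s)
      (𝓝[>] 0) (𝓝 ((∫ r in Set.Iic (0 : ℝ), φ r) • F t)) := by
  obtain ⟨G, hG, hGF, C, hC⟩ : ∃ G : ℝ → V, Continuous G ∧ (∀ s ∈ Set.Icc 0 t, G s = F s) ∧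
      ∃ C : ℝ, ∀ s, ‖G s‖ ≤ C := by
    have hcont : Continuous fun s : ℝ => F (Set.projIcc 0 t ht.le s) :=
      (continuousOn_iff_continuous_domRestrict.1 hF).comp continuous_projIcc
    obtain ⟨C, hC⟩ := isCompact_Icc.exists_bound_of_continuousOn hF
    exact ⟨_, hcont, fun s hs => by rw [Set.projIcc_of_mem _ hs],
      C, fun s => hC _ (Set.projIcc 0 t ht.le s).2⟩
  have e : ∀ l : ℝ, 0 < l →
      ∫ s in (0 : ℝ)..t, (((l ^ 2)⁻¹ : ℝ) * φ ((s - t) / l ^ 2)) • F s =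
      ∫ r in Set.Iic (0 : ℝ),
        (Set.Ioi (-(t / l ^ 2))).indicator (fun r => φ r • G (t + l ^ 2 * r)) r := by
    intro l hl
    have hl2 : l ^ 2 ≠ 0 := by positivity
    have h1 : ∫ s in (0 : ℝ)..t, (((l ^ 2)⁻¹ : ℝ) * φ ((s - t) / l ^ 2)) • F s =
        ∫ s in (0 : ℝ)..t, (l ^ 2)⁻¹ • (fun r => φ r • G (t + l ^ 2 * r)) (s / l ^ 2 - t / l ^ 2) := by
      refine intervalIntegral.integral_congr fun s hs => ?_
      rw [Set.uIcc_of_le ht.le] at hs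
      have h2 : t + l ^ 2 * (s / l ^ 2 - t / l ^ 2) = s := by field_simp; ring
      simp only [h2, hGF s hs]
      rw [sub_div, mul_smul, Complex.coe_smul]
    rw [h1, intervalIntegral.integral_smul,
      intervalIntegral.integral_comp_div_sub (fun r => φ r • G (t + l ^ 2 * r)) hl2, smul_smul, inv_mul_cancel₀ hl2, one_smul, zero_div, zero_sub, sub_self,
      intervalIntegral.integral_of_le (by simp only [Left.neg_nonpos_iff]; positivity),
      setIntegral_indicator measurableSet_Ioi, Set.inter_comm, Set.Ioi_inter_Iic]
  refine Tendsto.congr' (f₁ := fun l : ℝ => ∫ r in Set.Iic (0 : ℝ),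
    (Set.Ioi (-(t / l ^ 2))).indicator (fun r => φ r • G (t + l ^ 2 * r)) r) ?_ ?_
  · filter_upwards [self_mem_nhdsWithin] with l hl using (e l hl).symm
  · rw [← hGF t ⟨ht.le, le_rfl⟩, ← integral_smul_const]
    refine tendsto_integral_filter_of_dominated_convergence (fun r => ‖φ r‖ * C) ?_ ?_
      (hφ.norm.mul_const C).integrableOn ?_
    · refine Eventually.of_forall fun l => AEStronglyMeasurable.indicator ?_ measurableSet_Ioi
      exact hφ.1.restrict.smul
        (by fun_prop : Continuous fun r => G (t + l ^ 2 * r)).aestronglyMeasurable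
    · refine Eventually.of_forall fun l => Eventually.of_forall fun r => ?_
      refine (norm_indicator_le_norm_self _ _).trans ?_
      rw [norm_smul]
      exact mul_le_mul_of_nonneg_left (hC _) (norm_nonneg _)
    · refine Eventually.of_forall fun r => ?_
      have h1 : Tendsto (fun l : ℝ => φ r • G (t + l ^ 2 * r)) (𝓝[>] 0) (𝓝 (φ r • G t)) := by
        have : Continuous fun l : ℝ => φ r • G (t + l ^ 2 * r) := by fun_prop
        simpa using (this.tendsto 0).mono_left nhdsWithin_le_nhds
      refine h1.congr' ?_
      have h2 : Tendsto (fun l : ℝ => t + l ^ 2 * r) (𝓝[>] 0) (𝓝 t) := by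
        have : Continuous fun l : ℝ => t + l ^ 2 * r := by fun_prop
        simpa using (this.tendsto 0).mono_left nhdsWithin_le_nhds
      filter_upwards [h2.eventually (lt_mem_nhds ht), self_mem_nhdsWithin] with l hl hl0
      rw [Set.indicator_of_mem]
      have hl0 : 0 < l ^ 2 := pow_pos hl0 2
      rw [Set.mem_Ioi, ← neg_div, div_lt_iff₀ hl0]
      linarith

/-- Null vectors of a positive semidefinite sesquilinear form lie in its radical, by
Cauchy–Schwarz. -/
lemma eq_zero_of_self_eq_zero {V : Type*} [AddCommGroup V] [Module ℂ V] {B : V → V → ℂ}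
    (symm : ∀ x y, conj (B y x) = B x y) (nonneg : ∀ x, 0 ≤ (B x x).re)
    (add : ∀ x y z, B (x + y) z = B x z + B y z) (smul : ∀ x y (r : ℂ), B (r • x) y = conj r * B x y)
    {x : V} (hx : B x x = 0) (y : V) : B x y = 0 := by
  let c : PreInnerProductSpace.Core ℂ V :=
    { inner := B, conj_inner_symm := symm, re_inner_nonneg := nonneg, add_left := add,
      smul_left := smul }
  have h : ‖B x y‖ * ‖B y x‖ ≤ (B x x).re * (B y y).re :=
    InnerProductSpace.Core.inner_mul_inner_self_le x y
  rw [← symm y x, RCLike.norm_conj, hx, Complex.zero_re, zero_mul] at h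
  exact norm_eq_zero.1 (mul_self_eq_zero.1 (le_antisymm h (mul_self_nonneg _)))

/-! ### Elimination in a linear system -/

/-- The two causal equations, for `Z` and `W`, are linear; eliminating `W` gives
`(1 + γ γ' D D') D Z` in terms of `u`, and `T` inverts the coefficient. -/
lemma causal_system_solution {R : Type*} [Ring R] [Algebra ℂ R] {D D' T u Z W : R}
    {γ γ' p p' q q' : ℂ} (hT : T * (1 + (γ * γ') • (D * D')) = 1)
    (hT' : (1 + (γ * γ') • (D * D')) * T = 1)
    (hZ : Z = p' • u - (I * γ') • (D' * (W + q • u)))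
    (hW : W = p • u - (I * γ) • (D * (Z + q' • u))) :
    I • (D * Z) = (γ' • (D * D' * T)) * ((-I * γ * q') • (D * u) + q • u) +
      (p' • I • (T * D * u) + p • γ' • (D * D' * T * u)) := by
  have hcomm : D * D' * T = T * (D * D') :=
    calc D * D' * T = T * ((1 + (γ * γ') • (D * D')) * (D * D')) * T := by
          rw [← mul_assoc T, hT, one_mul]
      _ = T * (D * D' * (1 + (γ * γ') • (D * D'))) * T := by
          congr 2
          simp only [add_mul, mul_add, one_mul, mul_one, smul_mul_assoc, mul_smul_comm]
      _ = T * (D * D') := by rw [mul_assoc, mul_assoc (D * D'), hT', mul_one]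
  have h : (1 + (γ * γ') • (D * D')) * (D * Z) = p' • (D * u) - (I * γ' * p) • (D * D' * u)
      - (γ * γ' * q') • (D * D' * (D * u)) - (I * γ' * q) • (D * D' * u) := by
    have hDZ : D * Z = p' • (D * u) - (I * γ' * p) • (D * D' * u)
        + (I * I * γ * γ') • (D * D' * (D * Z)) + (I * I * γ * γ' * q') • (D * D' * (D * u))
        - (I * γ' * q) • (D * D' * u) := by
      conv_lhs => rw [hZ, hW]
      simp only [mul_add, mul_sub, mul_smul_comm, ← mul_assoc]
      module
    rw [I_mul_I] at hDZ
    rw [add_mul, one_mul, smul_mul_assoc]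
    conv_lhs => enter [1]; rw [hDZ]
    module
  have h' : D * Z = T * (p' • (D * u) - (I * γ' * p) • (D * D' * u)
      - (γ * γ' * q') • (D * D' * (D * u)) - (I * γ' * q) • (D * D' * u)) := by
    rw [← h, ← mul_assoc, hT, one_mul]
  rw [h', hcomm]
  simp only [mul_add, mul_sub, smul_mul_assoc, mul_smul_comm, mul_assoc, smul_sub]
  match_scalars <;> ring_nf
  simp [I_sq]

namespace Model

variable {d : ℕ} {HS : Type*} [NormedAddCommGroup HS] [InnerProductSpace ℂ HS] [CompleteSpace HS]
  (M : Model d HS)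

/-! ### Correlations of the form-factors -/

lemma inner_S_P₀ (t : ℝ) (x y : OneParticle d) :
    ⟪x, M.S t (M.P₀ y)⟫_ℂ = ⟪M.P₀ x, M.S t y⟫_ℂ := by
  have hP : ∀ h, M.P₀ (freeGroup M.ω M.measurable_ω t h)
      = freeGroup M.ω M.measurable_ω t (M.P₀ h) := fun h =>
    congrArg (fun A => A h) (M.P₀_comm t)
  rw [inner_P₀, S_apply, S_apply, hP, map_add M.P₀, map_smul M.P₀]

/-- Vectors separated by `P₀` are uncorrelated at all times. -/
lemma inner_S_eq_zero_of_P₀ (t : ℝ) {x y : OneParticle d}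
    (h : M.P₀ x = x ∧ M.P₀ y = 0 ∨ M.P₀ x = 0 ∧ M.P₀ y = y) : ⟪x, M.S t y⟫_ℂ = 0 := by
  rcases h with ⟨hx, hy⟩ | ⟨hx, hy⟩
  · rw [← hx, ← inner_S_P₀, hy, map_zero, inner_zero_right]
  · rw [← hy, inner_S_P₀, hx, inner_zero_left]

lemma P₀_g_of_ne {a c : Fin 2} (h : a ≠ c) :
    M.P₀ (M.g a) = M.g a ∧ M.P₀ (M.g c) = 0 ∨ M.P₀ (M.g a) = 0 ∧ M.P₀ (M.g c) = M.g c := by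
  fin_cases a <;> fin_cases c <;> first
    | exact absurd rfl h
    | exact Or.inl ⟨M.P₀_g_zero, M.P₀_g_one⟩
    | exact Or.inr ⟨M.P₀_g_one, M.P₀_g_zero⟩

lemma inner_g_S_g_of_ne {a c : Fin 2} (h : a ≠ c) (t : ℝ) : ⟪M.g a, M.S t (M.g c)⟫_ℂ = 0 :=
  M.inner_S_eq_zero_of_P₀ t (M.P₀_g_of_ne h)

lemma P₀_L (x : OneParticle d) : M.P₀ (M.L x) = M.L (M.P₀ x) :=
  congrArg (fun A => A x) M.P₀_comm_gibbs

lemma specDensity_g_of_ne {b e : Fin 2} (h : b ≠ e) (E : ℝ) :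
    M.specDensity (M.g b) (M.L (M.L (M.g e))) E = 0 := by
  have : ∀ t, ⟪M.g b, M.S t (M.L (M.L (M.g e)))⟫_ℂ = 0 := fun t => by
    refine M.inner_S_eq_zero_of_P₀ t ?_
    rw [P₀_L, P₀_L]
    rcases M.P₀_g_of_ne h with ⟨h1, h2⟩ | ⟨h1, h2⟩
    · exact Or.inl ⟨h1, by rw [h2, map_zero, map_zero]⟩
    · exact Or.inr ⟨h1, by rw [h2]⟩
  simp [specDensity, this]

lemma continuous_S_apply (x : OneParticle d) : Continuous fun t => M.S t x :=
  continuous_of_gram (M.continuous_inner_S x x) fun r s => M.inner_S_S r s x x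

lemma inner_S_neg (t : ℝ) (x y : OneParticle d) : ⟪x, M.S (-t) y⟫_ℂ = conj ⟪y, M.S t x⟫_ℂ := by
  have := M.inner_S_S t 0 x y
  rw [S_zero, zero_sub] at this
  rw [← this, inner_conj_symm]

lemma integrable_gibbs_mul_exp (x y : M.K) (E : ℝ) : Integrable fun t : ℝ =>
    ⟪(x : OneParticle d), M.S t (M.L (M.L y))⟫_ℂ * exp (-(t * E) * I) := by
  refine (M.integrable_K_gibbs x x.2 y y.2).mul_bdd (c := 1) ?_ (Eventually.of_forall fun t => ?_)
  · exact Continuous.aestronglyMeasurable (by fun_prop)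
  · rw [← ofReal_mul, ← ofReal_neg, norm_exp_ofReal_mul_I]

/-- Spectral densities are positive: `<x, P_E L² x> ≥ 0`, since
`<x, S_{s-r} L² x> e^{-i(s-r)E}` is the Gram kernel of the vectors `e^{-isE} S_s L x`. -/
lemma specDensity_gibbs_self_nonneg (x : M.K) (E : ℝ) :
    0 ≤ M.specDensity (x : OneParticle d) (M.L (M.L x)) E := by
  refine mul_nonneg ?_ (integral_nonneg_of_gram
    (F := fun r => exp (-(r * E) * I) • M.S r (M.L x)) ?_ (M.integrable_gibbs_mul_exp x x E) ?_)
  · rw [← ofReal_ofNat, ← ofReal_mul, ← ofReal_inv, zero_le_real]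
    positivity
  · exact (by fun_prop : Continuous fun r : ℝ => exp (-(r * E) * I)).smul (M.continuous_S_apply _)
  · intro r s
    rw [inner_smul_left, inner_smul_right, inner_S_S, inner_S_L_L, ← Complex.exp_conj, mul_left_comm,
      mul_comm _ (inner _ _ _), mul_comm (exp _), mul_assoc, ← Complex.exp_add]
    congr 2
    simp
    ring

lemma conj_specDensity_gibbs (x y : OneParticle d) (E : ℝ) :
    conj (M.specDensity y (M.L (M.L x)) E) = M.specDensity x (M.L (M.L y)) E := by
  rw [specDensity, specDensity, map_mul, ← integral_conj, ← integral_neg_eq_self]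
  congr 1
  · simp [← ofReal_ofNat, ← ofReal_mul, ← ofReal_inv]
  · refine integral_congr_ae (Eventually.of_forall fun t => ?_)
    simp only [inner_S_L_L, inner_S_neg, map_mul, conj_conj, ← Complex.exp_conj]
    simp

/-- Cauchy–Schwarz for `<x, P_E L² y>`: a vector of zero density at `E` is orthogonal to all of `K`
there. -/
lemma specDensity_gibbs_eq_zero {x : M.K} {E : ℝ}
    (h : M.specDensity (x : OneParticle d) (M.L (M.L x)) E = 0) (y : M.K) :
    M.specDensity (x : OneParticle d) (M.L (M.L y)) E = 0 := by
  refine eq_zero_of_self_eq_zero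
    (B := fun x y : M.K => M.specDensity (x : OneParticle d) (M.L (M.L y)) E)
    (fun x y => M.conj_specDensity_gibbs x y E)
    (fun x => (Complex.le_def.1 (M.specDensity_gibbs_self_nonneg x E)).1)
    (fun x y z => ?_) (fun x y r => ?_) h y
  · simp only [specDensity, ← mul_add]
    rw [← integral_add (M.integrable_gibbs_mul_exp x z E) (M.integrable_gibbs_mul_exp y z E)]
    simp only [Submodule.coe_add, inner_add_left, add_mul]
  · simp only [specDensity, Submodule.coe_smul, inner_smul_left, mul_assoc]
    rw [integral_const_mul, mul_left_comm]

/-- The noise `B_{a,b}(E, t)` vanishes where `<g_b, P_E L² g_b> = 0`. -/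
lemma amp_eq_zero (a : Fin 2) {b : Fin 2} {E : ℝ}
    (h : M.specDensity (M.g b) (M.L (M.L (M.g b))) E = 0) (t : ℝ) (f : M.TestFn) :
    M.amp a b E t f = 0 := by
  refine List.sum_eq_zero fun z hz => ?_
  obtain ⟨w, -, rfl⟩ := List.mem_map.1 hz
  rw [M.specDensity_gibbs_eq_zero (x := ⟨M.g b, M.g_mem b⟩) h w.2.2, map_zero, mul_zero, mul_zero]

/-- The product `n_e(E) <g_e, P_E L² g_e>` is `1` wherever the eigenvalue of
`B⁺_{a,e}(E, t)` is nonzero; in particular the junk value `n_e(E) = 0` does not occur there. -/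
lemma n_mul_specDensity_mul_amp (a e : Fin 2) (E t : ℝ) (f : M.TestFn) :
    M.n e E * M.specDensity (M.g e) (M.L (M.L (M.g e))) E * conj (M.amp a e E t f) =
      conj (M.amp a e E t f) := by
  by_cases h : M.specDensity (M.g e) (M.L (M.L (M.g e))) E = 0
  · rw [M.amp_eq_zero a h, map_zero, mul_zero]
  · rw [n, one_div_mul_cancel h, one_mul]

/-! ### The causal products -/

lemma preComm_eq_zero_of_ne {a b c e : Fin 2} (h : a ≠ c ∨ b ≠ e) (l E τ : ℝ) :
    M.preComm l a b c e E τ = 0 := by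
  rcases h with h | h
  · simp [preComm, M.inner_g_S_g_of_ne h]
  · simp [preComm, M.specDensity_g_of_ne h]

lemma sum_preComm_smul {V : Type*} [AddCommGroup V] [Module ℂ V] (l : ℝ) (a b : Fin 2) (E τ : ℝ)
    (v : Fin 2 → Fin 2 → V) :
    ∑ c, ∑ e, M.preComm l a b c e E τ • v c e = M.preComm l a b a b E τ • v a b := by
  rw [Finset.sum_eq_single a, Finset.sum_eq_single b]
  · exact fun e _ he => by rw [M.preComm_eq_zero_of_ne (Or.inr he.symm), zero_smul]
  · simp
  · exact fun c _ hc => Finset.sum_eq_zero fun e _ => by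
      rw [M.preComm_eq_zero_of_ne (Or.inl hc.symm), zero_smul]
  · simp

lemma integrable_g_mul_exp (a : Fin 2) (E : ℝ) : Integrable fun t : ℝ =>
    ⟪M.g a, M.S t (M.g a)⟫_ℂ * exp (-(t * E) * I) := by
  refine (M.integrable_K _ (M.g_mem a) _ (M.g_mem a)).mul_bdd (c := 1) ?_
    (Eventually.of_forall fun t => ?_)
  · exact Continuous.aestronglyMeasurable (by fun_prop)
  · rw [← ofReal_mul, ← ofReal_neg, norm_exp_ofReal_mul_I]

variable {M} {U : ℝ → M.StateSpace →L[ℂ] M.StateSpace} {BU : Fin 2 → Fin 2 → ℝ → ℝ → M.Form}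

/-- Matrix elements of `U` are continuous, because `U` solves an integral equation. -/
lemma IsEvolution.continuousOn_toForm (hU : M.IsEvolution U BU) {t : ℝ} (ht : 0 ≤ t)
    (f f₁ : M.TestFn) : ContinuousOn (fun s => M.toForm (U s) f f₁) (Set.Icc 0 t) := by
  have h := intervalIntegral.continuousOn_primitive_interval'
    (hU.intervalIntegrable t ht f f₁) Set.left_mem_uIcc
  rw [Set.uIcc_of_le ht] at h
  exact (continuousOn_const.sub (h.const_smul I)).congr fun s hs => hU.integral_eq s hs.1 f f₁

/-- The causal products in closed form: the creator `B⁺_{a,b}(E, t)` in `∂_t U_t` is the only one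
that is correlated with `B_{a,b}(E, t)`, and half of the delta function contributes. -/
lemma IsEvolution.causal_eq (hU : M.IsEvolution U BU) (a b : Fin 2) (E : ℝ) {t : ℝ} (ht : 0 < t)
    (f f₁ : M.TestFn) :
    BU a b E t f f₁ = M.amp a b E t f₁ • M.toForm (U t) f f₁ +
      (M.γ a E * M.specDensity (M.g b) (M.L (M.L (M.g b))) E) •
        M.creCoeff U BU a b E t f f₁ := by
  refine tendsto_nhds_unique (hU.causal a b E t ht f f₁) (Tendsto.const_add _ ?_)
  have hC : ContinuousOn (fun s => M.creCoeff U BU a b E s f f₁) (Set.Icc 0 t) := by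
    have h1 := (hU.continuousOn (1 - a) b E f f₁).mono (t := Set.Icc 0 t) fun s hs => hs.1
    have h2 := hU.continuousOn_toForm ht.le f f₁
    have h3 : ContinuousOn (fun s => M.n b E • BU (1 - a) b E s f f₁ +
        if b = 1 - a then M.toForm (U s) f f₁ else 0) (Set.Icc 0 t) := by
      refine (h1.const_smul (M.n b E)).add ?_
      split_ifs
      exacts [h2, continuousOn_const]
    refine ((continuousOn_const (c := M.D a)).clm_comp h3 |>.const_smul (-I)).congr fun s _ => ?_
    simp only [creCoeff, sysMul, Pi.smul_apply, Pi.add_apply]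
    split_ifs <;> rfl
  have h := (tendsto_integral_endpoint (M.integrable_g_mul_exp a E) ht hC).const_smul
    (M.specDensity (M.g b) (M.L (M.L (M.g b))) E)
  rw [smul_smul, mul_comm] at h
  refine h.congr fun l => ?_
  rw [← intervalIntegral.integral_smul]
  refine intervalIntegral.integral_congr fun s _ => ?_
  rw [M.sum_preComm_smul l a b E (s - t) fun c e => M.creCoeff U BU c e E s f f₁, preComm,
    conj_specDensity_gibbs, smul_smul]
  congr 1
  ring

/-- The causal equation for `B_{a,e}(E, t) U_t`, weighted by `n_e(E)` and the creator
`B⁺_{b,e}(E, t)`. The weight absorbs the spectral density, so that no case distinction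
on its vanishing is left. -/
lemma IsEvolution.weighted_causal_eq (hU : M.IsEvolution U BU) (a b e : Fin 2) (E : ℝ) {t : ℝ}
    (ht : 0 < t) (f f₁ : M.TestFn) :
    (M.n e E * conj (M.amp b e E t f)) • BU a e E t f f₁ =
      (M.n e E * conj (M.amp b e E t f) * M.amp a e E t f₁) • M.toForm (U t) f f₁ -
        (I * M.γ a E) • (M.D a * ((M.n e E * conj (M.amp b e E t f)) • BU (1 - a) e E t f f₁ +
          (if e = 1 - a then conj (M.amp b e E t f) else 0) • M.toForm (U t) f f₁)) := by
  have hn := M.n_mul_specDensity_mul_amp b e E t f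
  rw [hU.causal_eq a e E ht f f₁]
  have hC : M.creCoeff U BU a e E t f f₁ = (-I) • (M.D a * (M.n e E • BU (1 - a) e E t f f₁ +
      (if e = 1 - a then (1 : ℂ) else 0) • M.toForm (U t) f f₁)) := by
    simp only [creCoeff, sysMul, Pi.smul_apply, Pi.add_apply]
    split_ifs <;> simp [ContinuousLinearMap.mul_def]
  have hδ : (if e = 1 - a then conj (M.amp b e E t f) else 0) =
      conj (M.amp b e E t f) * if e = 1 - a then (1 : ℂ) else 0 := by
    rw [mul_ite, mul_one, mul_zero]
  rw [hC, hδ]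
  simp only [mul_add, mul_smul_comm, smul_add, smul_smul]
  match_scalars
  · ring
  · linear_combination (-I * M.γ a E * M.n e E) * hn
  · linear_combination (-I * M.γ a E * if e = 1 - a then (1 : ℂ) else 0) * hn

/-- The normally ordered integrand at energy `E` is `i D_ε` times the number density at `E`: it is
the sum over `e` of the solutions of the weighted causal equations; the terms without
`n_e(E)` are the contributions of the creators with `e = ε` and `e = 1 - ε`. -/
lemma IsEvolution.D_mul_numberDensity
    (hT : ∀ ε E, IsUnit (1 + (M.γ ε E * M.γ (1 - ε) E) • (M.D ε * M.D (1 - ε))))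
    (hU : M.IsEvolution U BU) (ε : Fin 2) {t : ℝ} (ht : 0 < t) (E : ℝ) (f f₁ : M.TestFn) :
    M.normallyOrdered U ε t E f f₁ =
      I • (M.D ε * M.numberDensity BU ε (1 - ε) E t f f₁) := by
  have hε : 1 - (1 - ε) = ε := sub_sub_cancel 1 ε
  have h : ∀ e, _ := fun e => causal_system_solution (Ring.inverse_mul_cancel _ (hT ε E))
    (Ring.mul_inverse_cancel _ (hT ε E))
    (by simpa only [hε] using hU.weighted_causal_eq (1 - ε) ε e E ht f f₁)
    (hU.weighted_causal_eq ε ε e E ht f f₁)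
  have hsum := Finset.sum_congr (rfl : (Finset.univ : Finset (Fin 2)) = _) fun e _ => h e
  rw [Finset.sum_add_distrib, ← Finset.mul_sum, Finset.sum_add_distrib, ← Finset.sum_smul,
    ← Finset.sum_smul, ← Finset.mul_sum, Finset.sum_ite_eq' Finset.univ ε,
    Finset.sum_ite_eq' Finset.univ (1 - ε), if_pos (Finset.mem_univ _),
    if_pos (Finset.mem_univ _), ← Finset.smul_sum, ← Finset.mul_sum] at hsum
  have hN : M.numberDensity BU ε (1 - ε) E t f f₁ =
      ∑ e, (M.n e E * conj (M.amp ε e E t f)) • BU (1 - ε) e E t f f₁ := by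
    simp only [numberDensity, creMul, Finset.sum_apply, Pi.smul_apply, smul_smul]
  rw [hN, hsum]
  simp only [normallyOrdered, sysMul, creMul, mulAnn, Pi.add_apply, Finset.sum_apply, Pi.smul_apply,
    T, ← ContinuousLinearMap.mul_def]
  congr 1
  · simp only [smul_mul_assoc, mul_smul_comm, smul_smul, mul_comm (-I * M.γ ε E)]
  · refine Finset.sum_congr rfl fun e _ => ?_
    simp only [smul_mul_assoc, mul_smul_comm, smul_smul, smul_add]
    congr 2 <;> ring

end Model
end LowDensity

theorem theorem3 {d : ℕ} {HS : Type*} [NormedAddCommGroup HS] [InnerProductSpace ℂ HS]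
    [CompleteSpace HS] (M : LowDensity.Model d HS)
    (hT : ∀ ε E, IsUnit (1 + (M.γ ε E * M.γ (1 - ε) E) • (M.D ε * M.D (1 - ε))))
    (U : ℝ → M.StateSpace →L[ℂ] M.StateSpace) (BU : Fin 2 → Fin 2 → ℝ → ℝ → M.Form)
    (hU : M.IsEvolution U BU) (ε : Fin 2) (t : ℝ) (ht : 0 < t) (f f₁ : M.TestFn) :
    MeasureTheory.Integrable (fun E => M.normallyOrdered U ε t E f f₁) ∧
      M.sysMul (-Complex.I • M.D ε) (M.numberAct BU ε (1 - ε) t) f f₁ =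
        -∫ E, M.normallyOrdered U ε t E f f₁ := by
  have hN := hU.integrable_number ε t ht.le f f₁
  have e : (fun E => M.normallyOrdered U ε t E f f₁) = fun E =>
      (ContinuousLinearMap.mul ℂ (HS →L[ℂ] HS) (Complex.I • M.D ε))
        (M.numberDensity BU ε (1 - ε) E t f f₁) := by
    funext E
    rw [hU.D_mul_numberDensity hT ε ht E f f₁, ContinuousLinearMap.mul_apply', smul_mul_assoc]
  rw [e]
  refine ⟨ContinuousLinearMap.integrable_comp _ hN, ?_⟩
  rw [ContinuousLinearMap.integral_comp_comm _ hN, ContinuousLinearMap.mul_apply', neg_smul,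
    ← neg_mul]
  rfl
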